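/- Let $(\mathcal X_j,d_j)_{j\in\mathbb Z}$ be metric spaces of diameter at most $1$, with their Borel $\sigma$-algebras, and let $(X_j)_{j\in\mathbb Z}$ be a two-sided Markov chain with $X_j\in\mathcal X_j$. Let $P_j(\cdot|x)$ be the law of $X_j$ given $X_{j+1}=x$, and $P_{j,n}(\cdot|x)$ the law of $(X_j,\dots,X_{j+n-1})$ given $X_{j+n}=x$. Let $\omega:[0,1]\to[0,1]$ be measurable and continuous at $0$ with $\omega(0)=0$, and let $a\in(0,1)$. Assume: (1) There is $\delta\in(0,1)$ with $\sup_A|P_j(A|x)-P_j(A|y)|\le\delta\,\omega(d_{j+1}(x,y))$ for all $j\in\mathbb Z$ and $x,y\in\mathcal X_{j+1}$. (2) There is an integer $n_0\ge1$ such that for all sufficiently small $r>0$ $$\inf_{j,b,x}P_{j,n_0}\Big(\Big\{y:\max_{j\le k<j+n_0}\omega(d_k(b_k,y_k))\le r\Big\}\,\Big|\,x\Big)>0,$$ the infimum being over $j\in\mathbb Z$, $b\in\prod_{j\le k<j+n_0}\mathcal X_k$ and $x\in\mathcal X_{j+n_0}$. (3) There is $C>0$ such that $\mathbb P(X_{j+1}\in\Gamma|X_j=x)\le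 C\,\mathbb P(X_{j+1}\in\Gamma)$ for all $j\in\mathbb Z$, $x\in\mathcal X_j$ and measurable $\Gamma\subseteq\mathcal X_{j+1}$, and the density $p_j(x,y)$ of $X_{j+1}$ given $X_j=x$, with respect to the law of $X_{j+1}$, satisfies $|p_j(x,y)-p_j(x',y)|\le C\omega(d_j(x,x'))$ for all $x,x',y$. Put $\mathcal Y=\prod_{k\in\mathbb Z}\mathcal X_k$ and $\mathcal X_{j,\infty}=\prod_{k\ge j}\mathcal X_k$. For a function $F$ on $\mathcal Y$ (resp. on $\mathcal X_{j,\infty}$) let $$\|F\|_{j,a,\omega}=\|F\|_{L^\infty}+\sup_{x\ne y}\frac{|F(x)-F(y)|}{\omega_{j,a}(x,y)},\qquad \omega_{j,a}(x,y)=\sup_n a^{|n|}\omega(d_{j+n}(x_{j+n},y_{j+n})),$$ where $n$ ranges over $\mathbb Z$ (resp. over $n\ge0$) and $L^\infty$ is taken with respect to the law of $(X_k)_{k\in\mathbb Z}$ (resp. of $(X_k)_{k\ge j}$). For $h>0$, a sequence $(F_j)_{j\ge0}$ of measurable functions on $\mathcal Y$ (resp. on $\mathcal X_{j,\infty}$)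 is called reducible to an $h\mathbb Z$-valued sequence, with respect to $(a,\omega)$, if $F_j=\mathbb E[F_j]+H_j+hZ_j$ for all $j\ge0$, where $H_j$, $Z_j$ are functions on the same spaces, $H_j$ is real valued and measurable, $Z_j$ is integer valued, $\sup_j\|H_j\|_{j,a,\omega}<\infty$, and the sequence of random variables $S_nH=\sum_{j=0}^{n-1}H_j$, evaluated along the chain, is tight. Let $f_j:\mathcal Y\to\mathbb R$, $j\ge0$, be measurable with $\sup_j\|f_j\|_{j,a,\omega}<\infty$, and let $u_j:\mathcal Y\to\mathbb R$ and $g_j:\mathcal X_{j,\infty}\to\mathbb R$ be measurable with $$\sup_j\|u_j\|_{j,a^{1/3},\omega^{1/3}}<\infty,\qquad \sup_j\|g_j\|_{j,a^{1/3},\omega^{1/3}}<\infty,\qquad f_j(x)=u_{j+1}(x)-u_j(x)+g_j(x_j,x_{j+1},\dots)$$ for all $j\ge 0$ and $x\in\mathcal Y$. Then for every $h>0$: $(g_j)$ is reducible to an $h\mathbb Z$-valued sequence, with respect to $(a^{1/3},\omega^{1/3})$, if and only if $(f_j)$ is reducible to an $h\mathbb Z$-valued sequence, with respect to $(a,\omega)$.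 -/

import Mathlib

open MeasureTheory ProbabilityTheory Set
open scoped ENNReal

namespace TwoSidedMarkov

/-- The space of paths `(x_j, x_{j+1}, ...)`. -/
abbrev Future (𝒳 : ℤ → Type*) (j : ℤ) : Type _ := ∀ k : Set.Ici j, 𝒳 k

/-- The space of finite paths `(x_k)` with `l ≤ k < m`. -/
abbrev Block (𝒳 : ℤ → Type*) (l m : ℤ) : Type _ := ∀ k : Set.Ico l m, 𝒳 k

/-- Conditions on the modulus `ω : [0,1] → [0,1]` (values outside `[0,1]` are irrelevant):
measurable, continuous at the origin, `ω 0 = 0`. -/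
structure IsModulus (ω : ℝ → ℝ) : Prop where
  measurable : Measurable ω
  mapsTo : ∀ t ∈ Set.Icc (0 : ℝ) 1, ω t ∈ Set.Icc (0 : ℝ) 1
  map_zero : ω 0 = 0
  continuous_zero : ContinuousWithinAt ω (Set.Icc 0 1) 0

section Moduli

variable {𝒳 : ℤ → Type*} [∀ j, MetricSpace (𝒳 j)]

/-- `ω_j(x,y) = sup_{n ≥ 0} a ^ n * ω (d (x_{j+n}, y_{j+n}))` on one-sided paths from time `j`. -/
noncomputable def oneSidedMod (a : ℝ) (ω : ℝ → ℝ) (j : ℤ) (x y : Future 𝒳 j) : ℝ :=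
  ⨆ n : ℕ, a ^ n * ω (dist (x ⟨j + n, by simp⟩) (y ⟨j + n, by simp⟩))

/-- `ω_{j,a}(x,y) = sup_{n ∈ ℤ} a ^ |n| * ω (d (x_{j+n}, y_{j+n}))` on two-sided paths. -/
noncomputable def twoSidedMod (a : ℝ) (ω : ℝ → ℝ) (j : ℤ) (x y : ∀ k, 𝒳 k) : ℝ :=
  ⨆ n : ℤ, a ^ n.natAbs * ω (dist (x (j + n)) (y (j + n)))

end Moduli

/-- The variation `sup {|g x - g y| / w x y : x ≠ y}`, where `c / 0 = ∞` for `c > 0`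
and `0 / 0 = 0`. -/
noncomputable def variation {S : Type*} (w : S → S → ℝ) (g : S → ℝ) : ℝ≥0∞ :=
  ⨆ (x : S) (y : S) (_ : x ≠ y), ENNReal.ofReal |g x - g y| / ENNReal.ofReal (w x y)

/-- The norm `‖g‖_{L^∞(ν)} + v_w(g)`, with value `∞` if it is not finite. -/
noncomputable def modNorm {S : Type*} [MeasurableSpace S] (ν : Measure S) (w : S → S → ℝ)
    (g : S → ℝ) : ℝ≥0∞ :=
  eLpNorm g ∞ ν + variation w g

section Kernels

variable {𝒳 : ℤ → Type*} [∀ j, MeasurableSpace (𝒳 j)]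

/-- Adjoins the coordinate `m - 1` to a path on `[m - 1 - n, m - 1)`. -/
def glue (n : ℕ) (m : ℤ) (q : 𝒳 (m - 1) × Block 𝒳 (m - 1 - n) (m - 1)) :
    Block 𝒳 (m - (n + 1 : ℕ)) m := fun k =>
  if h : (k : ℤ) = m - 1 then h ▸ q.1
  else q.2 ⟨k, by
    obtain ⟨k, hk1, hk2⟩ := k
    simp only [Set.mem_Ico] at *
    push_cast at hk1
    omega⟩

theorem measurable_glue (n : ℕ) (m : ℤ) : Measurable (glue (𝒳 := 𝒳) n m) := by
  refine measurable_pi_lambda _ fun k => ?_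
  obtain ⟨k, hk⟩ := k
  by_cases h : k = m - 1
  · subst h
    simpa [glue] using measurable_fst
  · simp only [glue, h, dite_false]
    exact (measurable_pi_apply _).comp measurable_snd

/-- `P m` is the transition kernel of `X_{m-1}` given `X_m`. Then `blockKernel P n m` is the kernel
of `(X_{m-n}, ..., X_{m-1})` given `X_m`: first `X_{m-1}` is drawn from `P m`, then
`(X_{m-1-n}, ..., X_{m-2})` given `X_{m-1}`. -/
noncomputable def blockKernel (P : ∀ m : ℤ, Kernel (𝒳 m) (𝒳 (m - 1))) :
    (n : ℕ) → (m : ℤ) → Kernel (𝒳 m) (Block 𝒳 (m - n) m)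
  | 0, m => Kernel.const _ (Measure.dirac fun k => absurd k.2 (by simp))
  | n + 1, m =>
      (P m ⊗ₖ Kernel.prodMkLeft (𝒳 m) (blockKernel P n (m - 1))).map (glue n m)

instance isMarkovKernel_blockKernel (P : ∀ m : ℤ, Kernel (𝒳 m) (𝒳 (m - 1)))
    [∀ m, IsMarkovKernel (P m)] (n : ℕ) (m : ℤ) : IsMarkovKernel (blockKernel P n m) := by
  induction n generalizing m with
  | zero => unfold blockKernel; infer_instance
  | succ n ih =>
    have := ih (m - 1)
    unfold blockKernel
    exact Kernel.IsMarkovKernel.map _ (measurable_glue n m)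

end Kernels

section Chain

variable {𝒳 : ℤ → Type*} [∀ j, MeasurableSpace (𝒳 j)] {Ω : Type*} [MeasurableSpace Ω]

/-- The random path `(X_j, X_{j+1}, ...)`. -/
def futurePath (X : ∀ j, Ω → 𝒳 j) (j : ℤ) (s : Ω) : Future 𝒳 j := fun k => X k s

/-- The law `κ_j` of `(X_j, X_{j+1}, ...)`. -/
noncomputable def futureLaw (μ : Measure Ω) (X : ∀ j, Ω → 𝒳 j) (j : ℤ) : Measure (Future 𝒳 j) :=
  μ.map (futurePath X j)

/-- The law of the whole path `(X_k)_{k ∈ ℤ}`. -/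
noncomputable def pathLaw (μ : Measure Ω) (X : ∀ j, Ω → 𝒳 j) : Measure (∀ k, 𝒳 k) :=
  μ.map fun s k => X k s

/-- `(X_j)_{j ∈ ℤ}` is a Markov chain with backward transition kernels `P`: for every `m`, the
conditional law of `X_{m-1}` given `(X_m, X_{m+1}, ...)` is `P m (X_m)`. (The Markov property is
symmetric under reversal of time.) -/
structure IsMarkovChain (μ : Measure Ω) (X : ∀ j, Ω → 𝒳 j)
    (P : ∀ m : ℤ, Kernel (𝒳 m) (𝒳 (m - 1))) : Prop where
  measurable : ∀ j, Measurable (X j)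
  backward : ∀ m : ℤ, μ.map (fun s => (futurePath X m s, X (m - 1) s)) =
    futureLaw μ X m ⊗ₘ
      (P m).comap (fun x : Future 𝒳 m => x ⟨m, Set.mem_Ici.2 le_rfl⟩) (measurable_pi_apply _)

/-- `Q j` is a version of the conditional law of `X_{j+1}` given `X_j`. -/
def IsForwardTransition (μ : Measure Ω) (X : ∀ j, Ω → 𝒳 j)
    (Q : ∀ j : ℤ, Kernel (𝒳 j) (𝒳 (j + 1))) : Prop :=
  ∀ j : ℤ, μ.map (fun s => (X j s, X (j + 1) s)) = μ.map (X j) ⊗ₘ Q j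

variable [∀ j, MetricSpace (𝒳 j)]

/-- Dobrushin contraction with modulus `ω`: for some `δ ∈ (0,1)`, the total variation distance
`sup_A |P(A|x) - P(A|y)|` of the backward transition laws is at most `δ * ω (d (x, y))`. -/
def ContractionAssumption (ω : ℝ → ℝ) (P : ∀ m : ℤ, Kernel (𝒳 m) (𝒳 (m - 1))) : Prop :=
  ∃ δ ∈ Set.Ioo (0 : ℝ) 1, ∀ (m : ℤ) (x y : 𝒳 m) (A : Set (𝒳 (m - 1))), MeasurableSet A →
    |(P m x).real A - (P m y).real A| ≤ δ * ω (dist x y)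

/-- Uniform positivity of balls: for some `n₀ ≥ 1` and all small `r > 0`, the conditional
probability, given `X_m = x`, that `ω (d (b_k, X_k)) ≤ r` for all `m - n₀ ≤ k < m` is bounded away
from zero uniformly in `m`, `b` and `x`. -/
def BallAssumption (ω : ℝ → ℝ) (P : ∀ m : ℤ, Kernel (𝒳 m) (𝒳 (m - 1))) : Prop :=
  ∃ n₀ : ℕ, 1 ≤ n₀ ∧ ∃ r₀ > (0 : ℝ), ∀ r ∈ Set.Ioo 0 r₀,
    0 < ⨅ (m : ℤ) (b : Block 𝒳 (m - n₀) m) (x : 𝒳 m),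
      blockKernel P n₀ m x {y | ∀ k, ω (dist (b k) (y k)) ≤ r}

/-- The forward transition laws are dominated by the one-dimensional marginals, up to a constant
`C`, and have densities `p_j(x,y)` with respect to them which satisfy
`|p_j(x,y) - p_j(x',y)| ≤ C ω(d_j(x,x'))`. -/
def ConditionalDensityAssumption (ω : ℝ → ℝ) (μ : Measure Ω) (X : ∀ j, Ω → 𝒳 j)
    (Q : ∀ j : ℤ, Kernel (𝒳 j) (𝒳 (j + 1))) : Prop :=
  ∃ C > (0 : ℝ),
    (∀ (j : ℤ) (x : 𝒳 j) (Γ : Set (𝒳 (j + 1))), MeasurableSet Γ →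
      (Q j x).real Γ ≤ C * (μ.map (X (j + 1))).real Γ) ∧
    ∃ p : ∀ j : ℤ, 𝒳 j → 𝒳 (j + 1) → ℝ,
      (∀ j, Measurable (Function.uncurry (p j))) ∧
      (∀ j x y, 0 ≤ p j x y) ∧
      (∀ j x, Q j x = (μ.map (X (j + 1))).withDensity fun y => ENNReal.ofReal (p j x y)) ∧
      ∀ j x x' y, |p j x y - p j x' y| ≤ C * ω (dist x x')

/-- `sup_{j ≥ 0} ‖F_j‖_{j,a,ω} < ∞` for functions of the two-sided path. -/
def TwoSidedBounded (μ : Measure Ω) (X : ∀ j, Ω → 𝒳 j) (a : ℝ) (ω : ℝ → ℝ)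
    (F : ℕ → (∀ k, 𝒳 k) → ℝ) : Prop :=
  ⨆ j : ℕ, modNorm (pathLaw μ X) (twoSidedMod a ω j) (F j) < ∞

/-- `sup_{j ≥ 0} ‖G_j‖_{j,a,ω} < ∞` for functions of the one-sided paths. -/
def OneSidedBounded (μ : Measure Ω) (X : ∀ j, Ω → 𝒳 j) (a : ℝ) (ω : ℝ → ℝ)
    (G : ∀ j : ℕ, Future 𝒳 j → ℝ) : Prop :=
  ⨆ j : ℕ, modNorm (futureLaw μ X j) (oneSidedMod a ω j) (G j) < ∞

/-- `(f_j)` is reducible to an `hℤ`-valued sequence, in the norms given by `a` and `ω`: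
`f_j = E[f_j] + H_j + h Z_j` with `Z_j` integer valued, `H_j` bounded in norm and the sums
`H_0 + ... + H_{n-1}` along the chain tight (two-sided functions). -/
def TwoSidedReducible (μ : Measure Ω) (X : ∀ j, Ω → 𝒳 j) (a : ℝ) (ω : ℝ → ℝ)
    (f : ℕ → (∀ k, 𝒳 k) → ℝ) (h : ℝ) : Prop :=
  ∃ (H : ℕ → (∀ k, 𝒳 k) → ℝ) (Z : ℕ → (∀ k, 𝒳 k) → ℤ),
    (∀ j, Measurable (H j)) ∧ TwoSidedBounded μ X a ω H ∧
    IsTightMeasureSet (Set.range fun n : ℕ =>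
      μ.map fun s => ∑ j ∈ Finset.range n, H j fun k => X k s) ∧
    ∀ j x, f j x = (∫ y, f j y ∂pathLaw μ X) + H j x + h * Z j x

/-- The same for functions of the one-sided paths. -/
def OneSidedReducible (μ : Measure Ω) (X : ∀ j, Ω → 𝒳 j) (a : ℝ) (ω : ℝ → ℝ)
    (g : ∀ j : ℕ, Future 𝒳 j → ℝ) (h : ℝ) : Prop :=
  ∃ (H : ∀ j : ℕ, Future 𝒳 j → ℝ) (Z : ∀ j : ℕ, Future 𝒳 j → ℤ),
    (∀ j, Measurable (H j)) ∧ OneSidedBounded μ X a ω H ∧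
    IsTightMeasureSet (Set.range fun n : ℕ =>
      μ.map fun s => ∑ j ∈ Finset.range n, H j (futurePath X j s)) ∧
    ∀ (j : ℕ) (x : Future 𝒳 j), g j x = (∫ y, g j y ∂futureLaw μ X j) + H j x + h * Z j x

/-- `f_j(x) = u_{j+1}(x) - u_j(x) + g_j(x_j, x_{j+1}, ...)` with `u_j`, `g_j` measurable and
uniformly bounded in the norms given by `a` and `ω`. All two-sided path spaces are identified, so
that no shift appears. -/
structure IsSinaiReduction (μ : Measure Ω) (X : ∀ j, Ω → 𝒳 j) (a : ℝ) (ω : ℝ → ℝ)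
    (f u : ℕ → (∀ k, 𝒳 k) → ℝ) (g : ∀ j : ℕ, Future 𝒳 j → ℝ) : Prop where
  measurable_u : ∀ j, Measurable (u j)
  measurable_g : ∀ j, Measurable (g j)
  bounded_u : TwoSidedBounded μ X a ω u
  bounded_g : OneSidedBounded μ X a ω g
  eq : ∀ (j : ℕ) (x : ∀ k, 𝒳 k), f j x = u (j + 1) x - u j x + g j fun k => x k

end Chain

end TwoSidedMarkov

/-! Write b = a^(1/3), σ = ω^(1/3); the modulus for (a, ω) is the cube of the one for (b, σ).

From g to f: adding the coboundary of the centred u_j to H_j gives a decomposition of f_j with the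
same integer part, and bounded coboundaries preserve tightness. This H' is a priori regular only for
(b, σ). But f_j is regular for (a, ω) and differs from H' by a constant and an element of hℤ. At
close points the integer cannot jump, so H' inherits the regularity of f_j; at distant points
boundedness suffices (`RegularWith.of_add_int_mul`).

From f to g: Sinai's trick (`exists_coboundary_add_future`) gives v_j such that H_j - v_j + v_{j+1}
depends only on the future. With t_j = u_j + v_j it follows that t_j - t_{j+1} is a function of the
future modulo hℤ. Paths with a common future merge as seen from later times, so telescoping makes
t_j itself such a function modulo hℤ (`sub_mem_zmultiples_of_eq_future`). Its past can then be
frozen to a fixed path β at the cost of an integer multiple of h, which gives one-sided H's whose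
sums differ from those of H_j by a bounded telescoping term. -/

namespace TwoSidedMarkov

/-! ### Pointwise regularity versus the norms -/

/-- `F` is bounded by `C` and has variation at most `C` with respect to `w`. -/
def RegularWith {S : Type*} (w : S → S → ℝ) (C : ℝ) (F : S → ℝ) : Prop :=
  (∀ x, |F x| ≤ C) ∧ ∀ x y, |F x - F y| ≤ C * w x y

namespace RegularWith

variable {S : Type*} {w : S → S → ℝ} {C D : ℝ} {F G : S → ℝ}

theorem add (hF : RegularWith w C F) (hG : RegularWith w D G) :
    RegularWith w (C + D) fun x => F x + G x := by
  refine ⟨fun x => (abs_add_le _ _).trans (add_le_add (hF.1 x) (hG.1 x)), fun x y => ?_⟩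
  rw [show F x + G x - (F y + G y) = (F x - F y) + (G x - G y) by ring, add_mul]
  exact (abs_add_le _ _).trans (add_le_add (hF.2 x y) (hG.2 x y))

theorem neg (hF : RegularWith w C F) : RegularWith w C fun x => -F x := by
  refine ⟨fun x => (abs_neg (F x)).trans_le (hF.1 x), fun x y => ?_⟩
  rw [show -F x - -F y = -(F x - F y) by ring, abs_neg]
  exact hF.2 x y

theorem sub (hF : RegularWith w C F) (hG : RegularWith w D G) :
    RegularWith w (C + D) fun x => F x - G x := by
  simpa only [sub_eq_add_neg] using hF.add hG.neg

theorem const (hw : ∀ x y, 0 ≤ w x y) {c : ℝ} (hc : |c| ≤ C) : RegularWith w C fun _ => c := by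
  refine ⟨fun _ => hc, fun x y => ?_⟩
  simpa using mul_nonneg ((abs_nonneg c).trans hc) (hw x y)

/-- Composition with a map that is Lipschitz for the moduli. -/
theorem comp {T : Type*} {v : T → T → ℝ} (hF : RegularWith w C F) (hC : 0 ≤ C) {e : T → S}
    {K : ℝ} (hK : 1 ≤ K) (he : ∀ x y, w (e x) (e y) ≤ K * v x y) :
    RegularWith v (C * K) fun x => F (e x) := by
  refine ⟨fun x => (hF.1 _).trans (le_mul_of_one_le_right hC hK), fun x y => ?_⟩
  rw [mul_assoc]
  exact (hF.2 _ _).trans (mul_le_mul_of_nonneg_left (he x y) hC)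

end RegularWith

theorem variation_le_of_regularWith {S : Type*} {w : S → S → ℝ} {C : ℝ} {F : S → ℝ}
    (hF : RegularWith w C F) (hC : 0 ≤ C) : variation w F ≤ ENNReal.ofReal C := by
  refine iSup_le fun x => iSup_le fun y => iSup_le fun _ => ENNReal.div_le_of_le_mul ?_
  rw [← ENNReal.ofReal_mul hC]
  exact ENNReal.ofReal_le_ofReal (hF.2 x y)

theorem abs_sub_le_of_variation_le {S : Type*} {w : S → S → ℝ} (hw : ∀ x y, 0 ≤ w x y) {C : ℝ}
    {F : S → ℝ} (hC : 0 ≤ C) (hF : variation w F ≤ ENNReal.ofReal C) (x y : S) :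
    |F x - F y| ≤ C * w x y := by
  by_cases hxy : x = y
  · subst hxy
    simpa using mul_nonneg hC (hw x x)
  have h1 : ENNReal.ofReal |F x - F y| / ENNReal.ofReal (w x y) ≤ ENNReal.ofReal C :=
    le_trans (le_iSup_of_le x <| le_iSup_of_le y <| le_iSup
      (fun _ : x ≠ y => ENNReal.ofReal |F x - F y| / ENNReal.ofReal (w x y)) hxy) hF
  by_cases h0 : ENNReal.ofReal |F x - F y| = 0
  · exact (ENNReal.ofReal_eq_zero.1 h0).trans (mul_nonneg hC (hw x y))
  rw [ENNReal.div_le_iff_le_mul (Or.inr ENNReal.ofReal_ne_top) (Or.inl ENNReal.ofReal_ne_top),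
    ← ENNReal.ofReal_mul hC] at h1
  · exact (ENNReal.ofReal_le_ofReal_iff (mul_nonneg hC (hw x y))).1 h1

/-- The essential bound holds at some point, and since w ≤ 1 the oscillation is at most D; hence the
bound D + D at every point, null sets included. -/
theorem exists_regularWith_of_iSup_modNorm_lt_top {ι : Type*} {S : ι → Type*}
    [∀ i, MeasurableSpace (S i)] (ν : ∀ i, Measure (S i)) [∀ i, IsProbabilityMeasure (ν i)]
    (w : ∀ i, S i → S i → ℝ) (hw : ∀ i x y, 0 ≤ w i x y) (hw1 : ∀ i x y, w i x y ≤ 1)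
    {F : ∀ i, S i → ℝ} (hF : ⨆ i, modNorm (ν i) (w i) (F i) < ∞) :
    ∃ C, 0 ≤ C ∧ ∀ i, RegularWith (w i) C (F i) := by
  set D : ℝ := (⨆ i, modNorm (ν i) (w i) (F i)).toReal
  have hD : 0 ≤ D := ENNReal.toReal_nonneg
  have hle : ∀ i, modNorm (ν i) (w i) (F i) ≤ ENNReal.ofReal D := fun i =>
    (le_iSup (fun i => modNorm (ν i) (w i) (F i)) i).trans (ENNReal.ofReal_toReal hF.ne).ge
  refine ⟨D + D, add_nonneg hD hD, fun i => ?_⟩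
  have hvar := abs_sub_le_of_variation_le (hw i) hD (le_add_self.trans (hle i))
  have hae : ∀ᵐ x ∂ν i, ‖F i x‖ₑ ≤ ENNReal.ofReal D := by
    have h := le_self_add.trans (hle i)
    rw [eLpNorm_exponent_top] at h
    exact ae_le_eLpNormEssSup.mono fun x hx => hx.trans h
  obtain ⟨x₀, hx₀⟩ := hae.exists
  rw [Real.enorm_eq_ofReal_abs, ENNReal.ofReal_le_ofReal_iff hD] at hx₀
  constructor
  · intro x
    have h1 := (hvar x x₀).trans (mul_le_of_le_one_right hD (hw1 i x x₀))
    have h2 := abs_add_le (F i x - F i x₀) (F i x₀)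
    rw [sub_add_cancel] at h2
    linarith
  · exact fun x y => (hvar x y).trans
      (mul_le_mul_of_nonneg_right (le_add_of_nonneg_left hD) (hw i x y))

theorem iSup_modNorm_lt_top {ι : Type*} {S : ι → Type*}
    [∀ i, MeasurableSpace (S i)] (ν : ∀ i, Measure (S i)) [∀ i, IsProbabilityMeasure (ν i)]
    (w : ∀ i, S i → S i → ℝ) {F : ∀ i, S i → ℝ} {C : ℝ} (hC : 0 ≤ C)
    (hF : ∀ i, RegularWith (w i) C (F i)) :
    ⨆ i, modNorm (ν i) (w i) (F i) < ∞ := by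
  refine lt_of_le_of_lt (iSup_le fun i => ?_)
    (ENNReal.add_lt_top.2 ⟨ENNReal.ofReal_lt_top (r := C), ENNReal.ofReal_lt_top (r := C)⟩)
  refine add_le_add ?_ (variation_le_of_regularWith (hF i) hC)
  refine (eLpNorm_le_of_ae_bound (C := C) (ae_of_all _ fun x => (hF i).1 x)).trans ?_
  simp

/-! ### Tightness under bounded perturbations -/

/-- Tightness is not affected by a uniformly bounded perturbation. -/
theorem isTightMeasureSet_of_abs_sub_le {Ω : Type*} [MeasurableSpace Ω] {μ : Measure Ω}
    {S T : ℕ → Ω → ℝ} (hS : ∀ n, Measurable (S n)) (hT : ∀ n, Measurable (T n)) {C : ℝ}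
    (hC : ∀ n s, |T n s - S n s| ≤ C)
    (h : IsTightMeasureSet (Set.range fun n => μ.map (S n))) :
    IsTightMeasureSet (Set.range fun n => μ.map (T n)) := by
  rw [isTightMeasureSet_iff_tendsto_measure_norm_gt] at h ⊢
  simp_rw [iSup_range] at h ⊢
  -- |T| > r forces |S| > r - C, so the tails of T are dominated by those of S shifted by C.
  have h' := h.comp (Filter.tendsto_atTop_add_const_right _ (-C) Filter.tendsto_id)
  refine tendsto_of_tendsto_of_tendsto_of_le_of_le tendsto_const_nhds h' (fun _ => zero_le)
    fun r => iSup_mono fun n => ?_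
  have hm : ∀ r : ℝ, MeasurableSet {x : ℝ | r < ‖x‖} := fun r =>
    measurableSet_lt measurable_const measurable_norm
  rw [Measure.map_apply (hT n) (hm _), Measure.map_apply (hS n) (hm _)]
  refine measure_mono fun s hs => ?_
  simp only [mem_preimage, mem_ofPred_eq, Real.norm_eq_abs, id] at hs ⊢
  have h1 := hC n s
  have h2 := abs_sub_abs_le_abs_sub (T n s) (S n s)
  linarith

/-! ### Changing the past of a path -/

section Paths

variable {𝒳 : ℤ → Type*}

/-- The two-sided path which extends `x` by the past of `β`. -/
noncomputable def extendPast (β : ∀ k, 𝒳 k) (j : ℤ) (x : Future 𝒳 j) : ∀ k, 𝒳 k := fun k =>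
  open Classical in if h : j ≤ k then x ⟨k, h⟩ else β k

/-- Replaces the coordinates of `x` before time `j` by those of `β`. -/
noncomputable def replacePast (β : ∀ k, 𝒳 k) (j : ℤ) (x : ∀ k, 𝒳 k) : ∀ k, 𝒳 k :=
  extendPast β j fun k => x k

theorem extendPast_of_le (β : ∀ k, 𝒳 k) {j k : ℤ} (h : j ≤ k) (x : Future 𝒳 j) :
    extendPast β j x k = x ⟨k, h⟩ := by simp [extendPast, h]

theorem replacePast_of_le (β : ∀ k, 𝒳 k) {j k : ℤ} (h : j ≤ k) (x : ∀ k, 𝒳 k) :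
    replacePast β j x k = x k := by simp [replacePast, extendPast, h]

theorem replacePast_of_lt (β : ∀ k, 𝒳 k) {j k : ℤ} (h : k < j) (x : ∀ k, 𝒳 k) :
    replacePast β j x k = β k := by simp [replacePast, extendPast, h]

theorem restrict_extendPast (β : ∀ k, 𝒳 k) (j : ℤ) (x : Future 𝒳 j) :
    (fun k : Ici j => extendPast β j x k) = x :=
  funext fun k => extendPast_of_le β k.2 x

theorem replacePast_congr (β : ∀ k, 𝒳 k) {j : ℤ} {x y : ∀ k, 𝒳 k}
    (hxy : ∀ k, j ≤ k → x k = y k) : replacePast β j x = replacePast β j y := by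
  funext k
  by_cases h : j ≤ k
  · rw [replacePast_of_le β h, replacePast_of_le β h, hxy k h]
  · rw [replacePast_of_lt β (not_le.1 h), replacePast_of_lt β (not_le.1 h)]

theorem measurable_extendPast [∀ j, MeasurableSpace (𝒳 j)] (β : ∀ k, 𝒳 k) (j : ℤ) :
    Measurable (extendPast β j) := by
  refine measurable_pi_lambda _ fun k => ?_
  by_cases h : j ≤ k
  · simpa [extendPast, h] using measurable_pi_apply _
  · simp [extendPast, h]

theorem measurable_restrict_Ici [∀ j, MeasurableSpace (𝒳 j)] (j : ℤ) :
    Measurable fun (x : ∀ k, 𝒳 k) => (fun k : Ici j => x k : Future 𝒳 j) :=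
  measurable_pi_lambda _ fun _ => measurable_pi_apply _

theorem measurable_replacePast [∀ j, MeasurableSpace (𝒳 j)] (β : ∀ k, 𝒳 k) (j : ℤ) :
    Measurable (replacePast β j) :=
  (measurable_extendPast β j).comp (measurable_restrict_Ici j)

end Paths

/-! ### The moduli -/

section Moduli

theorem IsModulus.rpow {ω : ℝ → ℝ} (hω : IsModulus ω) {p : ℝ} (hp : 0 < p) :
    IsModulus fun t => ω t ^ p where
  measurable := hω.measurable.pow_const p
  mapsTo t ht := ⟨Real.rpow_nonneg (hω.mapsTo t ht).1 p,
    Real.rpow_le_one (hω.mapsTo t ht).1 (hω.mapsTo t ht).2 hp.le⟩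
  map_zero := by simp [hω.map_zero, Real.zero_rpow hp.ne']
  continuous_zero := hω.continuous_zero.rpow_const (Or.inr hp.le)

variable {𝒳 : ℤ → Type*} [∀ j, MetricSpace (𝒳 j)] {a : ℝ} {ω : ℝ → ℝ}

theorem IsModulus.dist_mem (hω : IsModulus ω) (hdiam : ∀ (j : ℤ) (x y : 𝒳 j), dist x y ≤ 1)
    {j : ℤ} (x y : 𝒳 j) : ω (dist x y) ∈ Icc (0 : ℝ) 1 :=
  hω.mapsTo _ ⟨dist_nonneg, hdiam j x y⟩

theorem twoSidedMod_term_mem (ha : a ∈ Ioo (0 : ℝ) 1) (hω : IsModulus ω)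
    (hdiam : ∀ (j : ℤ) (x y : 𝒳 j), dist x y ≤ 1) (j : ℤ) (x y : ∀ k, 𝒳 k) (n : ℤ) :
    a ^ n.natAbs * ω (dist (x (j + n)) (y (j + n))) ∈ Icc (0 : ℝ) 1 := by
  have h := hω.dist_mem hdiam (x (j + n)) (y (j + n))
  exact ⟨mul_nonneg (pow_nonneg ha.1.le _) h.1,
    mul_le_one₀ (pow_le_one₀ ha.1.le ha.2.le) h.1 h.2⟩

theorem term_le_twoSidedMod (ha : a ∈ Ioo (0 : ℝ) 1) (hω : IsModulus ω)
    (hdiam : ∀ (j : ℤ) (x y : 𝒳 j), dist x y ≤ 1) (j : ℤ) (x y : ∀ k, 𝒳 k) (n : ℤ) :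
    a ^ n.natAbs * ω (dist (x (j + n)) (y (j + n))) ≤ twoSidedMod a ω j x y :=
  le_ciSup (f := fun n : ℤ => a ^ n.natAbs * ω (dist (x (j + n)) (y (j + n))))
    ⟨1, by rintro _ ⟨m, rfl⟩; exact (twoSidedMod_term_mem ha hω hdiam j x y m).2⟩ n

theorem twoSidedMod_nonneg (ha : a ∈ Ioo (0 : ℝ) 1) (hω : IsModulus ω)
    (hdiam : ∀ (j : ℤ) (x y : 𝒳 j), dist x y ≤ 1) (j : ℤ) (x y : ∀ k, 𝒳 k) :
    0 ≤ twoSidedMod a ω j x y :=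
  (twoSidedMod_term_mem ha hω hdiam j x y 0).1.trans (term_le_twoSidedMod ha hω hdiam j x y 0)

theorem twoSidedMod_le_one (ha : a ∈ Ioo (0 : ℝ) 1) (hω : IsModulus ω)
    (hdiam : ∀ (j : ℤ) (x y : 𝒳 j), dist x y ≤ 1) (j : ℤ) (x y : ∀ k, 𝒳 k) :
    twoSidedMod a ω j x y ≤ 1 :=
  ciSup_le fun n => (twoSidedMod_term_mem ha hω hdiam j x y n).2

theorem oneSidedMod_term_mem (ha : a ∈ Ioo (0 : ℝ) 1) (hω : IsModulus ω)
    (hdiam : ∀ (j : ℤ) (x y : 𝒳 j), dist x y ≤ 1) (j : ℤ) (x y : Future 𝒳 j) (n : ℕ) :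
    a ^ n * ω (dist (x ⟨j + n, by simp⟩) (y ⟨j + n, by simp⟩)) ∈ Icc (0 : ℝ) 1 := by
  have h := hω.dist_mem hdiam (x ⟨j + n, by simp⟩) (y ⟨j + n, by simp⟩)
  exact ⟨mul_nonneg (pow_nonneg ha.1.le _) h.1,
    mul_le_one₀ (pow_le_one₀ ha.1.le ha.2.le) h.1 h.2⟩

theorem term_le_oneSidedMod (ha : a ∈ Ioo (0 : ℝ) 1) (hω : IsModulus ω)
    (hdiam : ∀ (j : ℤ) (x y : 𝒳 j), dist x y ≤ 1) (j : ℤ) (x y : Future 𝒳 j) (n : ℕ) :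
    a ^ n * ω (dist (x ⟨j + n, by simp⟩) (y ⟨j + n, by simp⟩)) ≤ oneSidedMod a ω j x y :=
  le_ciSup (f := fun n : ℕ => a ^ n * ω (dist (x ⟨j + n, by simp⟩) (y ⟨j + n, by simp⟩)))
    ⟨1, by rintro _ ⟨m, rfl⟩; exact (oneSidedMod_term_mem ha hω hdiam j x y m).2⟩ n

theorem oneSidedMod_nonneg (ha : a ∈ Ioo (0 : ℝ) 1) (hω : IsModulus ω)
    (hdiam : ∀ (j : ℤ) (x y : 𝒳 j), dist x y ≤ 1) (j : ℤ) (x y : Future 𝒳 j) :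
    0 ≤ oneSidedMod a ω j x y :=
  (oneSidedMod_term_mem ha hω hdiam j x y 0).1.trans (term_le_oneSidedMod ha hω hdiam j x y 0)

theorem oneSidedMod_le_one (ha : a ∈ Ioo (0 : ℝ) 1) (hω : IsModulus ω)
    (hdiam : ∀ (j : ℤ) (x y : 𝒳 j), dist x y ≤ 1) (j : ℤ) (x y : Future 𝒳 j) :
    oneSidedMod a ω j x y ≤ 1 :=
  ciSup_le fun n => (oneSidedMod_term_mem ha hω hdiam j x y n).2

/-- Moving the base point by m changes each weight by at most a^m, because |m + n| ≤ m + |n|. -/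
theorem pow_mul_twoSidedMod_le (ha : a ∈ Ioo (0 : ℝ) 1) (hω : IsModulus ω)
    (hdiam : ∀ (j : ℤ) (x y : 𝒳 j), dist x y ≤ 1) (j : ℤ) (m : ℕ) (x y : ∀ k, 𝒳 k) :
    a ^ m * twoSidedMod a ω (j + m) x y ≤ twoSidedMod a ω j x y := by
  unfold twoSidedMod
  rw [Real.mul_iSup_of_nonneg (pow_nonneg ha.1.le m)]
  refine ciSup_le fun n => ?_
  refine le_trans ?_ (term_le_twoSidedMod ha hω hdiam j x y (m + n))
  have h := hω.dist_mem hdiam (x (j + (m + n))) (y (j + (m + n)))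
  rw [add_assoc, ← mul_assoc, ← pow_add]
  exact mul_le_mul_of_nonneg_right
    (pow_le_pow_of_le_one ha.1.le ha.2.le (by omega)) h.1

/-- Paths that agree from time `j` on are close at later times. -/
theorem twoSidedMod_le_pow_of_eq (ha : a ∈ Ioo (0 : ℝ) 1) (hω : IsModulus ω)
    (hdiam : ∀ (j : ℤ) (x y : 𝒳 j), dist x y ≤ 1) (j : ℤ) (m : ℕ) {x y : ∀ k, 𝒳 k}
    (hxy : ∀ k, j ≤ k → x k = y k) : twoSidedMod a ω (j + m) x y ≤ a ^ m := by
  refine ciSup_le fun n => ?_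
  by_cases hn : j ≤ j + m + n
  · rw [hxy _ hn, dist_self, hω.map_zero, mul_zero]
    exact pow_nonneg ha.1.le m
  · have h := hω.dist_mem hdiam (x (j + m + n)) (y (j + m + n))
    exact (mul_le_of_le_one_right (pow_nonneg ha.1.le _) h.2).trans
      (pow_le_pow_of_le_one ha.1.le ha.2.le (by omega))

theorem oneSidedMod_restrict_le (ha : a ∈ Ioo (0 : ℝ) 1) (hω : IsModulus ω)
    (hdiam : ∀ (j : ℤ) (x y : 𝒳 j), dist x y ≤ 1) (j : ℤ) (x y : ∀ k, 𝒳 k) :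
    oneSidedMod a ω j (fun k : Ici j => x k) (fun k : Ici j => y k) ≤ twoSidedMod a ω j x y :=
  ciSup_le fun n => by simpa using term_le_twoSidedMod ha hω hdiam j x y n

/-- Cubing is increasing on [0, ∞), so it commutes with the supremum of the termwise cubes. -/
theorem twoSidedMod_eq_pow_three {b : ℝ} {σ : ℝ → ℝ} (hb : b ∈ Ioo (0 : ℝ) 1)
    (hσ : IsModulus σ) (ha : a ∈ Ioo (0 : ℝ) 1) (hω : IsModulus ω) (hba : b ^ 3 = a)
    (hσω : ∀ t ∈ Icc (0 : ℝ) 1, σ t ^ 3 = ω t)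
    (hdiam : ∀ (j : ℤ) (x y : 𝒳 j), dist x y ≤ 1) (j : ℤ) (x y : ∀ k, 𝒳 k) :
    twoSidedMod a ω j x y = twoSidedMod b σ j x y ^ 3 := by
  have key : ∀ n : ℤ, a ^ n.natAbs * ω (dist (x (j + n)) (y (j + n))) =
      (b ^ n.natAbs * σ (dist (x (j + n)) (y (j + n)))) ^ 3 := fun n => by
    rw [← hσω _ ⟨dist_nonneg, hdiam _ _ _⟩, ← hba]
    ring
  have h0 := twoSidedMod_nonneg ha hω hdiam j x y
  apply le_antisymm
  · refine ciSup_le fun n => (key n).trans_le ?_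
    exact pow_le_pow_left₀ (twoSidedMod_term_mem hb hσ hdiam j x y n).1
      (term_le_twoSidedMod hb hσ hdiam j x y n) 3
  · have h1 : (twoSidedMod a ω j x y ^ (1 / 3 : ℝ)) ^ 3 = twoSidedMod a ω j x y := by
      rw [← Real.rpow_natCast, ← Real.rpow_mul h0]; norm_num
    rw [← h1]
    refine pow_le_pow_left₀ (twoSidedMod_nonneg hb hσ hdiam j x y) (ciSup_le fun n => ?_) 3
    refine le_of_pow_le_pow_left₀ three_ne_zero (Real.rpow_nonneg h0 _) ?_
    rw [h1, ← key]
    exact term_le_twoSidedMod ha hω hdiam j x y n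

theorem twoSidedMod_extendPast_le (ha : a ∈ Ioo (0 : ℝ) 1) (hω : IsModulus ω)
    (hdiam : ∀ (j : ℤ) (x y : 𝒳 j), dist x y ≤ 1) (β : ∀ k, 𝒳 k) (j : ℤ) (x y : Future 𝒳 j) :
    twoSidedMod a ω j (extendPast β j x) (extendPast β j y) ≤ oneSidedMod a ω j x y := by
  refine ciSup_le fun n => ?_
  by_cases hn : 0 ≤ n
  · lift n to ℕ using hn
    have h : j ≤ j + n := by omega
    rw [extendPast_of_le β h, extendPast_of_le β h]
    simpa using term_le_oneSidedMod ha hω hdiam j x y n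
  · have h : ¬ j ≤ j + n := by omega
    simp only [extendPast, h, dite_false, dist_self, hω.map_zero, mul_zero]
    exact oneSidedMod_nonneg ha hω hdiam j x y

theorem twoSidedMod_replacePast_le (ha : a ∈ Ioo (0 : ℝ) 1) (hω : IsModulus ω)
    (hdiam : ∀ (j : ℤ) (x y : 𝒳 j), dist x y ≤ 1) (β : ∀ k, 𝒳 k) (i j : ℤ) (x y : ∀ k, 𝒳 k) :
    twoSidedMod a ω i (replacePast β j x) (replacePast β j y) ≤ twoSidedMod a ω i x y := by
  refine ciSup_le fun n => ?_
  by_cases hn : j ≤ i + n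
  · rw [replacePast_of_le β hn, replacePast_of_le β hn]
    exact term_le_twoSidedMod ha hω hdiam i x y n
  · rw [replacePast_of_lt β (not_le.1 hn), replacePast_of_lt β (not_le.1 hn), dist_self,
      hω.map_zero, mul_zero]
    exact twoSidedMod_nonneg ha hω hdiam i x y

end Moduli


/-! ### Sinai's reduction to the future, and rigidity modulo hℤ -/

section Reduction

variable {𝒳 : ℤ → Type*} [∀ j, MetricSpace (𝒳 j)] {a b : ℝ} {ω σ : ℝ → ℝ}

/-- A sequence of functions of two-sided paths that is bounded in the norms given by `b ^ 3` and
`σ ^ 3` is, up to a coboundary which is bounded in the norms given by `b` and `σ`, a sequence of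
functions of the future. -/
theorem exists_coboundary_add_future [∀ j, MeasurableSpace (𝒳 j)] (hb : b ∈ Ioo (0 : ℝ) 1) (hσ : IsModulus σ)
    (ha : a ∈ Ioo (0 : ℝ) 1) (hω : IsModulus ω) (hba : b ^ 3 = a)
    (hσω : ∀ t ∈ Icc (0 : ℝ) 1, σ t ^ 3 = ω t)
    (hdiam : ∀ (j : ℤ) (x y : 𝒳 j), dist x y ≤ 1) (β : ∀ k, 𝒳 k)
    {F : ℕ → (∀ k, 𝒳 k) → ℝ} (hFm : ∀ j, Measurable (F j)) {C : ℝ} (hC : 0 ≤ C)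
    (hF : ∀ j : ℕ, RegularWith (twoSidedMod a ω j) C (F j)) :
    ∃ v : ℕ → (∀ k, 𝒳 k) → ℝ, (∀ j, Measurable (v j)) ∧
      (∃ D, 0 ≤ D ∧ ∀ j : ℕ, RegularWith (twoSidedMod b σ j) D (v j)) ∧
      ∀ (j : ℕ) (x y : ∀ k, 𝒳 k), (∀ k, (j : ℤ) ≤ k → x k = y k) →
        F j x - v j x + v (j + 1) x = F j y - v j y + v (j + 1) y := by
  set r : ℕ → (∀ k, 𝒳 k) → ∀ k, 𝒳 k := fun j => replacePast β j with hr
  have hfuture : ∀ (j n : ℕ) (x y : ∀ k, 𝒳 k), (∀ k, (j : ℤ) ≤ k → x k = y k) →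
      |F (j + n) x - F (j + n) y| ≤ 2 * C * b ^ n := fun j n x y hxy => by
    have h1 := twoSidedMod_le_pow_of_eq ha hω hdiam j n hxy
    have h2 := (hF (j + n)).2 x y
    push_cast at h2
    have h3 : a ^ n ≤ b ^ n := pow_le_pow_left₀ ha.1.le
      (by rw [← hba]; exact pow_le_of_le_one hb.1.le hb.2.le three_ne_zero) n
    calc _ ≤ C * b ^ n := h2.trans (mul_le_mul_of_nonneg_left (h1.trans h3) hC)
      _ ≤ 2 * C * b ^ n := by
        have := mul_nonneg hC (pow_nonneg hb.1.le n)
        linarith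
  have hrx : ∀ (j : ℕ) (x : ∀ k, 𝒳 k), ∀ k, (j : ℤ) ≤ k → x k = r j x k := fun j x k hk =>
    (replacePast_of_le β hk x).symm
  -- The n-th term of v_j: the effect on F_{j+n} of freezing the past before j, which is O(b^n).
  set d : ℕ → ℕ → (∀ k, 𝒳 k) → ℝ := fun j n x => F (j + n) x - F (j + n) (r j x) with hd
  have hd1 : ∀ j n x, |d j n x| ≤ 2 * C * b ^ n := fun j n x => hfuture j n x _ (hrx j x)
  have hgeo : HasSum (fun n : ℕ => b ^ n) (1 - b)⁻¹ := hasSum_geometric_of_lt_one hb.1.le hb.2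
  have hsum : ∀ j x, Summable fun n => d j n x := fun j x =>
    Summable.of_norm_bounded (hgeo.mul_left (2 * C)).summable fun n => hd1 j n x
  have hd2 : ∀ (j n : ℕ) x y,
      |d j n x - d j n y| ≤ 2 * C * twoSidedMod b σ j x y * b ^ n := fun j n x y => by
    set T := twoSidedMod b σ j x y with hT
    have hT0 : 0 ≤ T := twoSidedMod_nonneg hb hσ hdiam j x y
    have hbn : 0 < b ^ n := pow_pos hb.1 n
    -- The cube root is spent here. If T ≤ b^(2n), regularity of F_{j+n} bounds each difference by C
    -- b^(-3n) T³ ≤ C T b^n. If T ≥ b^(2n), each of the two terms is already at most C b^(3n) ≤ C T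
    -- b^n.
    rcases le_total T (b ^ n * b ^ n) with h | h
    · have e1 : ∀ x' y' : ∀ k, 𝒳 k, twoSidedMod a ω j x' y' ≤ twoSidedMod a ω j x y →
          |F (j + n) x' - F (j + n) y'| ≤ C * (T * b ^ n) := fun x' y' h' => by
        have h1 := pow_mul_twoSidedMod_le ha hω hdiam j n x' y'
        have h2 := (hF (j + n)).2 x' y'
        push_cast at h2
        refine h2.trans (mul_le_mul_of_nonneg_left ?_ hC)
        have h3 := h1.trans h'
        rw [twoSidedMod_eq_pow_three hb hσ ha hω hba hσω hdiam j x y, ← hT,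
          show a ^ n = (b ^ n) ^ 3 by rw [← hba]; ring] at h3
        refine le_of_mul_le_mul_left (h3.trans ?_) (pow_pos hbn 3)
        have h4 : T * T ≤ (b ^ n * b ^ n) * (b ^ n * b ^ n) := mul_le_mul h h hT0 (by positivity)
        have h5 := mul_le_mul_of_nonneg_left h4 hT0
        linarith [show T ^ 3 = T * (T * T) by ring,
          show (b ^ n) ^ 3 * (T * b ^ n) = T * (b ^ n * b ^ n * (b ^ n * b ^ n)) by ring]
      have h1 := e1 x y le_rfl
      have h2 := e1 (r j x) (r j y) (twoSidedMod_replacePast_le ha hω hdiam β j j x y)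
      have h3 := abs_sub (F (j + n) x - F (j + n) y) (F (j + n) (r j x) - F (j + n) (r j y))
      rw [show d j n x - d j n y = (F (j + n) x - F (j + n) y) -
        (F (j + n) (r j x) - F (j + n) (r j y)) by simp only [hd]; ring]
      linarith
    · have e1 : ∀ x', |d j n x'| ≤ C * (T * b ^ n) := fun x' => by
        have h1 := twoSidedMod_le_pow_of_eq ha hω hdiam j n (hrx j x')
        have h2 := (hF (j + n)).2 x' (r j x')
        push_cast at h2
        refine h2.trans (mul_le_mul_of_nonneg_left (h1.trans ?_) hC)
        rw [← hba, ← pow_mul, mul_comm 3 n, pow_mul]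
        have h3 := mul_le_mul_of_nonneg_right h hbn.le
        linarith [show (b ^ n) ^ 3 = b ^ n * b ^ n * b ^ n by ring]
      have h1 := abs_sub (d j n x) (d j n y)
      linarith [e1 x, e1 y]
  refine ⟨fun j x => ∑' n, d j n x, fun j => ?_, ⟨2 * C * (1 - b)⁻¹, ?_, fun j => ⟨fun x => ?_,
    fun x y => ?_⟩⟩, fun j x y hxy => ?_⟩
  · have hdm : ∀ n, Measurable (d j n) := fun n =>
      (hFm _).sub ((hFm _).comp (measurable_replacePast β j))
    refine measurable_of_tendsto_metrizable (fun N => Finset.measurable_fun_sum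
      (Finset.range N) fun n _ => hdm n) (tendsto_pi_nhds.2 fun x => ?_)
    exact (hsum j x).hasSum.tendsto_sum_nat
  · have : 0 ≤ (1 - b)⁻¹ := inv_nonneg.2 (sub_nonneg.2 hb.2.le)
    positivity
  · exact tsum_of_norm_bounded (f := fun n => d j n x) (hgeo.mul_left (2 * C)) fun n => hd1 j n x
  · rw [← (hsum j x).tsum_sub (hsum j y)]
    refine (tsum_of_norm_bounded (f := fun n => d j n x - d j n y)
      (hgeo.mul_left (2 * C * twoSidedMod b σ j x y)) fun n => hd2 j n x y).trans_eq (by ring)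
  -- The n = 0 term of v_j turns F_j(x) into F_j(r_j x), and in the remaining terms the values at x
  -- itself cancel against v_{j+1}. Only r_j x and r_{j+1} x survive, and both are determined by the
  -- future.
  · have key : ∀ x, F j x - ∑' n, d j n x + ∑' n, d (j + 1) n x =
        F j (r j x) + ∑' n, (F (j + 1 + n) (r j x) - F (j + 1 + n) (r (j + 1) x)) := fun x => by
      have hs := (summable_nat_add_iff 1).2 (hsum j x)
      rw [(hsum j x).tsum_eq_zero_add]
      have : ∀ n, F (j + 1 + n) (r j x) - F (j + 1 + n) (r (j + 1) x) =
          d (j + 1) n x - d j (n + 1) x := fun n => by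
        simp only [hd, show j + (n + 1) = j + 1 + n by ring]
        ring
      simp_rw [this]
      rw [(hsum (j + 1) x).tsum_sub hs]
      simp only [hd, add_zero]
      ring
    rw [key x, key y, show r j x = r j y from replacePast_congr β hxy,
      show r (j + 1) x = r (j + 1) y from
        replacePast_congr β fun k hk => hxy k (by push_cast at hk; omega)]

/-- If `t_j - t_{j+1}` is, modulo `h ℤ`, a function of the future, then so is `t_j`. -/
theorem sub_mem_zmultiples_of_eq_future (hb : b ∈ Ioo (0 : ℝ) 1) (hσ : IsModulus σ)
    (hdiam : ∀ (j : ℤ) (x y : 𝒳 j), dist x y ≤ 1) {t : ℕ → (∀ k, 𝒳 k) → ℝ} {D : ℝ}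
    (hD : 0 ≤ D) (ht : ∀ j : ℕ, RegularWith (twoSidedMod b σ j) D (t j)) {h : ℝ}
    (hdiff : ∀ (j : ℕ) (x y : ∀ k, 𝒳 k), (∀ k, (j : ℤ) ≤ k → x k = y k) →
      (t j x - t (j + 1) x) - (t j y - t (j + 1) y) ∈ AddSubgroup.zmultiples h)
    (j : ℕ) (x y : ∀ k, 𝒳 k) (hxy : ∀ k, (j : ℤ) ≤ k → x k = y k) :
    t j x - t j y ∈ AddSubgroup.zmultiples h := by
  have hmem : ∀ n : ℕ, (t j x - t j y) - (t (j + n) x - t (j + n) y) ∈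
      AddSubgroup.zmultiples h := fun n => by
    induction n with
    | zero => simp
    | succ n ih =>
      have h1 := add_mem ih (hdiff (j + n) x y fun k hk => hxy k (by push_cast at hk; omega))
      rw [← add_assoc]
      convert! h1 using 1
      ring
  have hlim : Filter.Tendsto (fun n : ℕ => t (j + n) x - t (j + n) y) Filter.atTop (nhds 0) := by
    have h0 := (tendsto_pow_atTop_nhds_zero_of_lt_one hb.1.le hb.2).const_mul D
    rw [mul_zero] at h0
    refine squeeze_zero_norm (fun n => ?_) h0
    have h2 := (ht (j + n)).2 x y
    push_cast at h2
    exact h2.trans (mul_le_mul_of_nonneg_left (twoSidedMod_le_pow_of_eq hb hσ hdiam j n hxy) hD)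
  -- The differences at time j + n tend to 0, so t_j x - t_j y is a limit of elements of the closed
  -- group hℤ.
  have hclosed : IsClosed (AddSubgroup.zmultiples h : Set ℝ) := AddSubgroup.isClosed_of_discrete
  have := hclosed.mem_of_tendsto (hlim.const_sub (t j x - t j y))
    (Filter.Eventually.of_forall hmem)
  simpa using this

/-- Needed for the terms u_{j+1} and v_{j+1} of a coboundary, which are measured at time j; the
shift costs a factor b⁻¹. -/
theorem RegularWith.of_succ (hb : b ∈ Ioo (0 : ℝ) 1) (hσ : IsModulus σ)
    (hdiam : ∀ (j : ℤ) (x y : 𝒳 j), dist x y ≤ 1) {C : ℝ} (hC : 0 ≤ C) {j : ℕ}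
    {F : (∀ k, 𝒳 k) → ℝ} (hF : RegularWith (twoSidedMod b σ (j + 1 : ℕ)) C F) :
    RegularWith (twoSidedMod b σ j) (C * b⁻¹) F := by
  refine hF.comp (e := id) hC ((one_le_inv₀ hb.1).2 hb.2.le) fun x y => ?_
  rw [inv_mul_eq_div, le_div_iff₀ hb.1, mul_comm]
  simpa using pow_mul_twoSidedMod_le hb hσ hdiam j 1 x y

end Reduction

/-! ### Laws of paths and futures -/

section Laws

variable {𝒳 : ℤ → Type*} [∀ j, MeasurableSpace (𝒳 j)] {Ω : Type*} [MeasurableSpace Ω]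
  {μ : Measure Ω} {X : ∀ j : ℤ, Ω → 𝒳 j}

theorem isProbabilityMeasure_pathLaw [IsProbabilityMeasure μ] (hX : ∀ j, Measurable (X j)) :
    IsProbabilityMeasure (pathLaw μ X) :=
  Measure.isProbabilityMeasure_map (measurable_pi_lambda _ hX).aemeasurable

theorem measurable_futurePath (hX : ∀ j, Measurable (X j)) (j : ℤ) :
    Measurable (futurePath X j) :=
  measurable_pi_lambda _ fun k => hX k

theorem isProbabilityMeasure_futureLaw [IsProbabilityMeasure μ] (hX : ∀ j, Measurable (X j)) (j : ℤ) :
    IsProbabilityMeasure (futureLaw μ X j) :=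
  Measure.isProbabilityMeasure_map (measurable_futurePath hX j).aemeasurable

theorem integral_futureLaw (hX : ∀ j, Measurable (X j)) {j : ℤ} {G : Future 𝒳 j → ℝ}
    (hG : Measurable G) :
    ∫ y, G y ∂futureLaw μ X j = ∫ x, G (fun k => x k) ∂pathLaw μ X := by
  have h : futureLaw μ X j = (pathLaw μ X).map fun x => (fun k => x k : Future 𝒳 j) := by
    rw [futureLaw, pathLaw, Measure.map_map (measurable_restrict_Ici j)
      (measurable_pi_lambda _ hX)]
    rfl
  rw [h, integral_map (measurable_restrict_Ici j).aemeasurable hG.aestronglyMeasurable]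

end Laws

/-! ### Transfer of reducibility in both directions -/

section Equivalence

variable {𝒳 : ℤ → Type*} [∀ j, MetricSpace (𝒳 j)] [∀ j, MeasurableSpace (𝒳 j)]
  {Ω : Type*} [MeasurableSpace Ω] {μ : Measure Ω} [IsProbabilityMeasure μ]
  {X : ∀ j : ℤ, Ω → 𝒳 j} {a b : ℝ} {ω σ : ℝ → ℝ}

theorem exists_regularWith_of_twoSidedBounded (hX : ∀ j, Measurable (X j))
    (ha : a ∈ Ioo (0 : ℝ) 1) (hω : IsModulus ω) (hdiam : ∀ (j : ℤ) (x y : 𝒳 j), dist x y ≤ 1)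
    {F : ℕ → (∀ k, 𝒳 k) → ℝ} (hF : TwoSidedBounded μ X a ω F) :
    ∃ C, 0 ≤ C ∧ ∀ j : ℕ, RegularWith (twoSidedMod a ω j) C (F j) :=
  have := isProbabilityMeasure_pathLaw (μ := μ) hX
  exists_regularWith_of_iSup_modNorm_lt_top (S := fun _ : ℕ => ∀ k, 𝒳 k) (fun _ => pathLaw μ X)
    (fun j => twoSidedMod a ω j) (fun j => twoSidedMod_nonneg ha hω hdiam j)
    (fun j => twoSidedMod_le_one ha hω hdiam j) hF

theorem twoSidedBounded_of_regularWith (hX : ∀ j, Measurable (X j))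
    {F : ℕ → (∀ k, 𝒳 k) → ℝ} {C : ℝ} (hC : 0 ≤ C)
    (hF : ∀ j : ℕ, RegularWith (twoSidedMod a ω j) C (F j)) : TwoSidedBounded μ X a ω F :=
  have := isProbabilityMeasure_pathLaw (μ := μ) hX
  iSup_modNorm_lt_top (S := fun _ : ℕ => ∀ k, 𝒳 k) (fun _ => pathLaw μ X) _ hC hF

theorem exists_regularWith_of_oneSidedBounded (hX : ∀ j, Measurable (X j))
    (ha : a ∈ Ioo (0 : ℝ) 1) (hω : IsModulus ω) (hdiam : ∀ (j : ℤ) (x y : 𝒳 j), dist x y ≤ 1)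
    {G : ∀ j : ℕ, Future 𝒳 j → ℝ} (hG : OneSidedBounded μ X a ω G) :
    ∃ C, 0 ≤ C ∧ ∀ j : ℕ, RegularWith (oneSidedMod a ω j) C (G j) :=
  have := fun j : ℕ => isProbabilityMeasure_futureLaw (μ := μ) hX j
  exists_regularWith_of_iSup_modNorm_lt_top (S := fun j : ℕ => Future 𝒳 j)
    (fun j => futureLaw μ X j) (fun j => oneSidedMod a ω j)
    (fun j => oneSidedMod_nonneg ha hω hdiam j) (fun j => oneSidedMod_le_one ha hω hdiam j) hG

theorem oneSidedBounded_of_regularWith (hX : ∀ j, Measurable (X j))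
    {G : ∀ j : ℕ, Future 𝒳 j → ℝ} {C : ℝ} (hC : 0 ≤ C)
    (hG : ∀ j : ℕ, RegularWith (oneSidedMod a ω j) C (G j)) : OneSidedBounded μ X a ω G :=
  have := fun j : ℕ => isProbabilityMeasure_futureLaw (μ := μ) hX j
  iSup_modNorm_lt_top (S := fun j : ℕ => Future 𝒳 j) (fun j => futureLaw μ X j) _ hC hG

theorem abs_integral_le_of_regularWith {S : Type*} [MeasurableSpace S] {ν : Measure S}
    [IsProbabilityMeasure ν] {w : S → S → ℝ} {C : ℝ} {F : S → ℝ} (hF : RegularWith w C F) :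
    |∫ x, F x ∂ν| ≤ C := by
  simpa using norm_integral_le_of_norm_le_const (μ := ν) (f := F) (ae_of_all _ hF.1)

theorem RegularWith.integrable {S : Type*} [MeasurableSpace S] {ν : Measure S}
    [IsProbabilityMeasure ν] {w : S → S → ℝ} {C : ℝ} {F : S → ℝ} (hF : RegularWith w C F)
    (hm : Measurable F) : Integrable F ν :=
  Integrable.of_bound hm.aestronglyMeasurable C (ae_of_all _ hF.1)

variable {f u : ℕ → (∀ k, 𝒳 k) → ℝ} {g : ∀ j : ℕ, Future 𝒳 j → ℝ}

theorem IsSinaiReduction.integral_eq (hX : ∀ j, Measurable (X j)) (hb : b ∈ Ioo (0 : ℝ) 1)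
    (hσ : IsModulus σ) (hdiam : ∀ (j : ℤ) (x y : 𝒳 j), dist x y ≤ 1)
    (hg : IsSinaiReduction μ X b σ f u g) (j : ℕ) :
    ∫ x, f j x ∂pathLaw μ X = (∫ x, u (j + 1) x ∂pathLaw μ X) - (∫ x, u j x ∂pathLaw μ X) +
      ∫ y, g j y ∂futureLaw μ X j := by
  have := isProbabilityMeasure_pathLaw (μ := μ) hX
  obtain ⟨C, -, hu⟩ := exists_regularWith_of_twoSidedBounded hX hb hσ hdiam hg.bounded_u
  obtain ⟨D, -, hgD⟩ := exists_regularWith_of_oneSidedBounded hX hb hσ hdiam hg.bounded_g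
  have hui := fun j => (hu j).integrable (ν := pathLaw μ X) (hg.measurable_u j)
  have hgi : Integrable (fun x : ∀ k, 𝒳 k => g j fun k => x k) (pathLaw μ X) :=
    Integrable.of_bound ((hg.measurable_g j).comp (measurable_restrict_Ici _)).aestronglyMeasurable
      D (ae_of_all _ fun x => (hgD j).1 _)
  have hsub : Integrable (fun x => u (j + 1) x - u j x) (pathLaw μ X) := (hui _).sub (hui _)
  rw [integral_futureLaw hX (hg.measurable_g j), ← integral_sub (hui _) (hui _),
    ← integral_add hsub hgi]
  exact integral_congr_ae (ae_of_all _ fun x => hg.eq j x)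

/-- Away from jumps of an integer-valued function, a function has the regularity of its class
modulo `h ℤ`. -/
theorem RegularWith.of_add_int_mul {S : Type*} {w v : S → S → ℝ} (hw : ∀ x y, 0 ≤ w x y)
    (hw1 : ∀ x y, w x y ≤ 1) (hv : ∀ x y, v x y = w x y ^ 3) {H F : S → ℝ} {Z : S → ℤ}
    {h C D c : ℝ} (hh : 0 < h) (hC : 0 ≤ C) (hD : 0 ≤ D) (hH : RegularWith w C H)
    (hF : RegularWith v D F) (hFHZ : ∀ x, F x = c + H x + h * Z x) :
    RegularWith v (C + D + C * ((C + D) / h) ^ 3) H := by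
  have hK : 0 ≤ (C + D) / h := by positivity
  have hK3 : 0 ≤ C * ((C + D) / h) ^ 3 := by positivity
  refine ⟨fun x => (hH.1 x).trans (by linarith), fun x y => ?_⟩
  have hv0 : 0 ≤ v x y := by rw [hv]; exact pow_nonneg (hw x y) 3
  have hvw : v x y ≤ w x y := by
    rw [hv]; exact pow_le_of_le_one (hw x y) (hw1 x y) three_ne_zero
  -- Below this threshold h |Z x - Z y| < h, so the integer does not jump and H x - H y = F x - F y.
  by_cases hlt : (C + D) * w x y < h
  · have hZ : |h * ((Z x - Z y : ℤ) : ℝ)| < h := by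
      have h1 := abs_sub (F x - F y) (H x - H y)
      rw [show h * ((Z x - Z y : ℤ) : ℝ) = (F x - F y) - (H x - H y) by
        rw [hFHZ x, hFHZ y]; push_cast; ring]
      have h2 := (hF.2 x y).trans (mul_le_mul_of_nonneg_left hvw hD)
      linarith [hH.2 x y]
    have hZ0 : Z x - Z y = 0 := by
      rw [abs_mul, abs_of_pos hh, mul_lt_iff_lt_one_right hh] at hZ
      exact Int.abs_lt_one_iff.1 (by exact_mod_cast hZ)
    have : H x - H y = F x - F y := by
      rw [hFHZ x, hFHZ y, sub_eq_zero.1 hZ0]; ring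
    rw [this]
    exact (hF.2 x y).trans (mul_le_mul_of_nonneg_right (by linarith) hv0)
  -- Here w ≥ h / (C + D), so the crude bound C is absorbed by a multiple of w³ = v.
  · have h1 : 1 ≤ ((C + D) / h * w x y) ^ 3 := one_le_pow₀ (by
      rw [div_mul_eq_mul_div, one_le_div hh]; exact not_lt.1 hlt)
    calc |H x - H y| ≤ C * w x y := hH.2 x y
      _ ≤ C * 1 := mul_le_mul_of_nonneg_left (hw1 x y) hC
      _ ≤ C * ((C + D) / h * w x y) ^ 3 := mul_le_mul_of_nonneg_left h1 hC
      _ = C * ((C + D) / h) ^ 3 * v x y := by rw [hv]; ring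
      _ ≤ _ := mul_le_mul_of_nonneg_right (by linarith) hv0

theorem IsSinaiReduction.twoSidedReducible (hX : ∀ j, Measurable (X j))
    (hb : b ∈ Ioo (0 : ℝ) 1) (hσ : IsModulus σ)
    (ha : a ∈ Ioo (0 : ℝ) 1) (hω : IsModulus ω) (hba : b ^ 3 = a)
    (hσω : ∀ t ∈ Icc (0 : ℝ) 1, σ t ^ 3 = ω t)
    (hdiam : ∀ (j : ℤ) (x y : 𝒳 j), dist x y ≤ 1) (hg : IsSinaiReduction μ X b σ f u g)
    (hfb : TwoSidedBounded μ X a ω f) {h : ℝ} (hh : 0 < h)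
    (hred : OneSidedReducible μ X b σ g h) : TwoSidedReducible μ X a ω f h := by
  have := isProbabilityMeasure_pathLaw (μ := μ) hX
  obtain ⟨H, Z, hHm, hHb, hHt, hgHZ⟩ := hred
  obtain ⟨A, hA, hu⟩ := exists_regularWith_of_twoSidedBounded hX hb hσ hdiam hg.bounded_u
  obtain ⟨B, hB, hH⟩ := exists_regularWith_of_oneSidedBounded hX hb hσ hdiam hHb
  obtain ⟨D, hD, hf⟩ := exists_regularWith_of_twoSidedBounded hX ha hω hdiam hfb
  have hw := fun j : ℤ => twoSidedMod_nonneg hb hσ hdiam j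
  have hpath : Measurable fun s k => X k s := measurable_pi_lambda _ hX
  -- Centring u makes the expectations of f_j and g_j match, so no constants are left to accumulate
  -- in the sums of H'.
  set V : ℕ → (∀ k, 𝒳 k) → ℝ := fun j x => u j x - ∫ y, u j y ∂pathLaw μ X with hV
  have hVr : ∀ j : ℕ, RegularWith (twoSidedMod b σ j) (A + A) (V j) := fun j =>
    (hu j).sub (RegularWith.const (hw j) (abs_integral_le_of_regularWith (hu j)))
  have hVm : ∀ j, Measurable (V j) := fun j => (hg.measurable_u j).sub_const _
  set H' : ℕ → (∀ k, 𝒳 k) → ℝ := fun j x => V (j + 1) x - V j x + H j fun k => x k with hH'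
  have hH'm : ∀ j, Measurable (H' j) := fun j =>
    ((hVm _).sub (hVm _)).add ((hHm j).comp (measurable_restrict_Ici _))
  have hH'r : ∀ j : ℕ, RegularWith (twoSidedMod b σ j) ((A + A) * b⁻¹ + (A + A) + B * 1) (H' j) :=
    fun j => ((RegularWith.of_succ hb hσ hdiam (by positivity) (hVr (j + 1))).sub (hVr j)).add
      ((hH j).comp hB le_rfl fun x y => by
        rw [one_mul]; exact oneSidedMod_restrict_le hb hσ hdiam j x y)
  have heq : ∀ j x, f j x = (∫ y, f j y ∂pathLaw μ X) + H' j x + h * Z j fun k => x k :=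
    fun j x => by
      rw [hg.integral_eq hX hb hσ hdiam j, hg.eq j x, hgHZ]
      simp only [hH', hV]
      ring
  have hb0 := hb.1
  have hE : 0 ≤ (A + A) * b⁻¹ + (A + A) + B * 1 := by positivity
  refine ⟨H', fun j x => Z j fun k => x k, hH'm, ?_, ?_, heq⟩
  · refine twoSidedBounded_of_regularWith hX ?_ fun j =>
      RegularWith.of_add_int_mul (hw j) (twoSidedMod_le_one hb hσ hdiam j)
        (twoSidedMod_eq_pow_three hb hσ ha hω hba hσω hdiam j) hh hE hD (hH'r j) (hf j) (heq j)
    positivity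
  -- The sums differ by V_n - V_0, and |V_j| ≤ 2A.
  · refine isTightMeasureSet_of_abs_sub_le (C := 4 * A) (fun n => Finset.measurable_fun_sum _
      fun j _ => (hHm j).comp (measurable_futurePath hX j)) (fun n =>
      Finset.measurable_fun_sum _ fun j _ => (hH'm j).comp hpath) (fun n s => ?_) hHt
    have : ∀ x : ∀ k, 𝒳 k, ∑ j ∈ Finset.range n, H' j x -
        ∑ j ∈ Finset.range n, H j (fun k => x k) = V n x - V 0 x := fun x => by
      rw [← Finset.sum_sub_distrib, ← Finset.sum_range_sub (fun j => V j x)]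
      exact Finset.sum_congr rfl fun j _ => by simp [hH']
    refine (congrArg abs (this fun k => X k s)).trans_le ?_
    have h1 := abs_sub (V n fun k => X k s) (V 0 fun k => X k s)
    linarith [(hVr n).1 fun k => X k s, (hVr 0).1 fun k => X k s]

theorem IsSinaiReduction.oneSidedReducible (hX : ∀ j, Measurable (X j))
    (hb : b ∈ Ioo (0 : ℝ) 1) (hσ : IsModulus σ)
    (ha : a ∈ Ioo (0 : ℝ) 1) (hω : IsModulus ω) (hba : b ^ 3 = a)
    (hσω : ∀ t ∈ Icc (0 : ℝ) 1, σ t ^ 3 = ω t)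
    (hdiam : ∀ (j : ℤ) (x y : 𝒳 j), dist x y ≤ 1) (hg : IsSinaiReduction μ X b σ f u g)
    {h : ℝ} (hred : TwoSidedReducible μ X a ω f h) : OneSidedReducible μ X b σ g h := by
  have := isProbabilityMeasure_pathLaw (μ := μ) hX
  obtain ⟨s₀⟩ : Nonempty Ω := nonempty_of_isProbabilityMeasure μ
  -- Any fixed path would do; a realised one shows that the path space is nonempty.
  set β : ∀ k, 𝒳 k := fun k => X k s₀
  obtain ⟨H, Z, hHm, hHb, hHt, hfHZ⟩ := hred
  obtain ⟨A, hA, hu⟩ := exists_regularWith_of_twoSidedBounded hX hb hσ hdiam hg.bounded_u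
  obtain ⟨B, hB, hH⟩ := exists_regularWith_of_twoSidedBounded hX ha hω hdiam hHb
  obtain ⟨v, hvm, ⟨D, hD, hv⟩, hHv⟩ :=
    exists_coboundary_add_future hb hσ ha hω hba hσω hdiam β hHm hB hH
  have hw := fun j : ℤ => twoSidedMod_nonneg hb hσ hdiam j
  have hpath : Measurable fun s k => X k s := measurable_pi_lambda _ hX
  have hHr : ∀ j : ℕ, RegularWith (twoSidedMod b σ j) B (H j) := fun j =>
    ⟨(hH j).1, fun x y => ((hH j).2 x y).trans (mul_le_mul_of_nonneg_left (by
      rw [twoSidedMod_eq_pow_three hb hσ ha hω hba hσω hdiam j x y]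
      exact pow_le_of_le_one (hw j x y) (twoSidedMod_le_one hb hσ hdiam j x y) three_ne_zero) hB)⟩
  set t : ℕ → (∀ k, 𝒳 k) → ℝ := fun j x => u j x + v j x with ht
  have htr : ∀ j : ℕ, RegularWith (twoSidedMod b σ j) (A + D) (t j) := fun j => (hu j).add (hv j)
  have htm : ∀ j, Measurable (t j) := fun j => (hg.measurable_u j).add (hvm j)
  -- t_j - t_{j+1} = g_j - E f_j - (H_j - v_j + v_{j+1}) - h Z_j, where everything but the last term
  -- depends on the future or is constant.
  have htmem := sub_mem_zmultiples_of_eq_future (h := h) hb hσ hdiam (add_nonneg hA hD) htr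
    fun j x y hxy => by
      have h1 := hHv j x y hxy
      have h2 : g j (fun k => x k) = g j fun k => y k :=
        congrArg (g j) (funext fun k => hxy k k.2)
      refine AddSubgroup.mem_zmultiples_iff.2 ⟨Z j y - Z j x, ?_⟩
      have hx := hg.eq j x
      have hy := hg.eq j y
      rw [hfHZ] at hx hy
      simp only [ht, zsmul_eq_mul, Int.cast_sub]
      linarith
  set E : ℕ → ℝ := fun j => ∫ x, u j x ∂pathLaw μ X with hE
  have hEA : ∀ j, |E j| ≤ A := fun j => abs_integral_le_of_regularWith (hu j)
  -- Without the replacement in t_{j+1} this would be g_j - E g_j - h Z_j. Evaluating t_{j+1} at the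
  -- past frozen before j + 1 changes it by an element of hℤ and makes the sums along the chain
  -- telescope, since the next summand evaluates t_{j+1} at the same point.
  set G : ℕ → (∀ k, 𝒳 k) → ℝ := fun j x =>
    E (j + 1) - E j + u j x - t (j + 1) (replacePast β (j + 1 : ℕ) x) + H j x + v (j + 1) x with hG
  have hGm : ∀ j, Measurable (G j) := fun j =>
    (((measurable_const.add (hg.measurable_u j)).sub ((htm _).comp
      (measurable_replacePast β _))).add (hHm j)).add (hvm _)
  have hb0 := hb.1
  obtain ⟨M, hM, hGr⟩ : ∃ M, 0 ≤ M ∧ ∀ j : ℕ, RegularWith (twoSidedMod b σ j) M (G j) := by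
    refine ⟨A + A + A + (A + D) * 1 * b⁻¹ + B + D * b⁻¹, by positivity, fun j => ?_⟩
    refine ((((RegularWith.const (hw j) ((abs_sub _ _).trans
      (add_le_add (hEA _) (hEA _)))).add (hu j)).sub (RegularWith.of_succ hb hσ hdiam
      (by positivity) ((htr (j + 1)).comp (by positivity) le_rfl fun x y => ?_))).add
      (hHr j)).add (RegularWith.of_succ hb hσ hdiam hD (hv (j + 1)))
    rw [one_mul]
    exact twoSidedMod_replacePast_le hb hσ hdiam β _ _ x y
  have hint : ∀ (j : ℕ) (x : Future 𝒳 j), ∃ z : ℤ,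
      g j x = (∫ y, g j y ∂futureLaw μ X j) + G j (extendPast β j x) + h * z := fun j x => by
    obtain ⟨z, hz⟩ := AddSubgroup.mem_zmultiples_iff.1 (htmem (j + 1) (extendPast β j x)
      (replacePast β (j + 1 : ℕ) (extendPast β j x)) fun k hk => (replacePast_of_le β hk _).symm)
    refine ⟨Z j (extendPast β j x) - z, ?_⟩
    have h1 := hg.eq j (extendPast β j x)
    rw [restrict_extendPast, hfHZ, hg.integral_eq hX hb hσ hdiam j] at h1
    rw [zsmul_eq_mul] at hz
    simp only [hG, ht, hE, Int.cast_sub] at hz ⊢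
    linarith
  choose Z' hZ' using hint
  refine ⟨fun j x => G j (extendPast β j x), Z', fun j => (hGm j).comp (measurable_extendPast β j),
    oneSidedBounded_of_regularWith hX (mul_nonneg hM zero_le_one) fun j =>
      (hGr j).comp hM le_rfl fun x y => by
        rw [one_mul]; exact twoSidedMod_extendPast_le hb hσ hdiam β j x y, ?_, hZ'⟩
  refine isTightMeasureSet_of_abs_sub_le (C := 4 * (A + D)) (fun n => Finset.measurable_fun_sum _
    fun j _ => (hHm j).comp hpath) (fun n => Finset.measurable_fun_sum _ fun j _ =>
    ((hGm j).comp (measurable_extendPast β j)).comp (measurable_futurePath hX j)) (fun n s => ?_) hHt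
  set x : ∀ k, 𝒳 k := fun k => X k s
  -- The transfer function between G_j(r_j x) and H_j(x). As |E_j| ≤ A, |t_j| ≤ A + D and |v_j| ≤ D,
  -- it is at most 2(A + D), hence the constant 4(A + D).
  set W : ℕ → ℝ := fun j => E j - t j (replacePast β j x) + v j x with hWdef
  have hW : ∀ j, |W j| ≤ 2 * (A + D) := fun j => by
    have h1 := abs_add_le (E j - t j (replacePast β j x)) (v j x)
    have h2 := abs_sub (E j) (t j (replacePast β j x))
    linarith [hEA j, (htr j).1 (replacePast β j x), (hv j).1 x]
  have hstep : ∀ j : ℕ, G j (replacePast β j x) - H j x = W (j + 1) - W j := fun j => by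
    have h1 := hHv j x (replacePast β j x) fun k hk => (replacePast_of_le β hk x).symm
    have h2 : replacePast β (j + 1 : ℕ) (replacePast β j x) = replacePast β (j + 1 : ℕ) x :=
      replacePast_congr β fun k hk => replacePast_of_le β (by push_cast at hk; omega) x
    simp only [hG, h2, hWdef, ht]
    linarith
  have : ∑ j ∈ Finset.range n, G j (extendPast β j (futurePath X j s)) -
      ∑ j ∈ Finset.range n, H j x = W n - W 0 := by
    rw [← Finset.sum_sub_distrib, ← Finset.sum_range_sub W]
    exact Finset.sum_congr rfl fun j _ => hstep j
  refine (congrArg abs this).trans_le ?_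
  have h1 := abs_sub (W n) (W 0)
  linarith [hW n, hW 0]

end Equivalence

end TwoSidedMarkov
open TwoSidedMarkov in
theorem mainTheorem11 {𝒳 : ℤ → Type*} [∀ j, MetricSpace (𝒳 j)] [∀ j, MeasurableSpace (𝒳 j)]
    [∀ j, BorelSpace (𝒳 j)] (hdiam : ∀ (j : ℤ) (x y : 𝒳 j), dist x y ≤ 1)
    {Ω : Type*} [MeasurableSpace Ω] (μ : Measure Ω) [IsProbabilityMeasure μ]
    (X : ∀ j : ℤ, Ω → 𝒳 j)
    (P : ∀ m : ℤ, Kernel (𝒳 m) (𝒳 (m - 1))) [∀ m, IsMarkovKernel (P m)]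
    (Q : ∀ j : ℤ, Kernel (𝒳 j) (𝒳 (j + 1))) [∀ j, IsMarkovKernel (Q j)]
    (hX : IsMarkovChain μ X P) (hQ : IsForwardTransition μ X Q)
    (ω : ℝ → ℝ) (hω : IsModulus ω) (a : ℝ) (ha : a ∈ Set.Ioo (0 : ℝ) 1)
    (hcontr : ContractionAssumption ω P) (hball : BallAssumption ω P)
    (hcond : ConditionalDensityAssumption ω μ X Q)
    (f : ℕ → (∀ k, 𝒳 k) → ℝ) (hf : ∀ j, Measurable (f j)) (hfb : TwoSidedBounded μ X a ω f)
    (u : ℕ → (∀ k, 𝒳 k) → ℝ) (g : ∀ j : ℕ, Future 𝒳 j → ℝ)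
    (hg : IsSinaiReduction μ X (a ^ (1 / 3 : ℝ)) (fun t => ω t ^ (1 / 3 : ℝ)) f u g)
    (h : ℝ) (hh : 0 < h) :
    OneSidedReducible μ X (a ^ (1 / 3 : ℝ)) (fun t => ω t ^ (1 / 3 : ℝ)) g h ↔
      TwoSidedReducible μ X a ω f h := by
  have hthird : (0 : ℝ) < 1 / 3 := by norm_num
  have hcube : ∀ t : ℝ, 0 ≤ t → (t ^ (1 / 3 : ℝ)) ^ 3 = t := fun t ht => by
    rw [← Real.rpow_natCast, ← Real.rpow_mul ht]; norm_num
  have hb : a ^ (1 / 3 : ℝ) ∈ Ioo (0 : ℝ) 1 :=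
    ⟨Real.rpow_pos_of_pos ha.1 _, Real.rpow_lt_one ha.1.le ha.2 hthird⟩
  have hσω : ∀ t ∈ Icc (0 : ℝ) 1, (ω t ^ (1 / 3 : ℝ)) ^ 3 = ω t := fun t ht =>
    hcube _ (hω.mapsTo t ht).1
  exact ⟨hg.twoSidedReducible hX.measurable hb (hω.rpow hthird) ha hω (hcube a ha.1.le) hσω hdiam
    hfb hh, hg.oneSidedReducible hX.measurable hb (hω.rpow hthird) ha hω (hcube a ha.1.le) hσω
    hdiam⟩
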